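/- Let $\mathcal X$ be a finite alphabet with $|\mathcal X|=n\ge 3$ and let $\alpha\in(0,\tfrac1n)\cup(\tfrac1n,\tfrac1{n-1})$. Let $X$ be uniformly distributed on $\mathcal X$, and let $Y$, with values in $\mathcal Y=\mathcal X$, be the output of the $n$-ary Hamming channel with crossover probability $\alpha$ and input $X$, that is, $p_{Y|X}(y|x)=1-(n-1)\alpha$ if $x=y$ and $p_{Y|X}(y|x)=\alpha$ if $x\ne y$. For $R\in[0,H(X)]=[0,\log n]$ let $$\mathrm{IB}(R)=\max\{\,I(Y;T)\;:\;p_{T|X},\ Y-X-T \text{ is a Markov chain},\ I(X;T)\le R\,\},$$ where the maximum is over all channels $p_{T|X}$ from $\mathcal X$ to any finite alphabet $\mathcal T$. Then there is $R_c\in(0,\log n)$ such that for every $R\in(0,R_c)$: every channel $p_{T|X}:\mathcal X\to\mathcal T$, $\mathcal T$ finite, that attains the maximum in $\mathrm{IB}(R)$ has $|\mathcal T|\ge n+1$; and the maximum is attained by some $p_{T|X}$ with $|\mathcal T|=n+1$. Thus for these $R$ the smallest alphabet size that attains $\mathrm{IB}(R)$ is exactly $|\mathcal X|+1$, so that the Witsenhausen--Wyner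 cardinality bound, by which $|\mathcal X|+1$ letters always suffice, is tight. -/

import Mathlib

namespace InfoBottleneck

/-- `W x y` is the conditional probability of the output `y` given the input `x`:
every row is a probability vector. -/
def IsChannel {X Y : Type*} [Fintype Y] (W : X → Y → ℝ) : Prop :=
  ∀ x, W x ∈ stdSimplex ℝ Y

/-- Mutual information (natural logarithm) of a joint law `q` on a product of finite alphabets,
`∑ q(a,b) log (q(a,b) / (q(a) q(b)))`, with the convention `0 log 0 = 0`. -/
noncomputable def mutualInfo {A B : Type*} [Fintype A] [Fintype B] (q : A → B → ℝ) : ℝ :=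
  ∑ a, ∑ b, q a b * Real.log (q a b / ((∑ b', q a b') * (∑ a', q a' b)))

/-- Joint law of `(X, T)`, when `X` has law `p` and `T` is generated from `X` by `K`. -/
def jointXT {X T : Type*} (p : X → ℝ) (K : X → T → ℝ) : X → T → ℝ :=
  fun x t => p x * K x t

/-- Joint law of `(Y, T)`, when `Y - X - T` is a Markov chain, `X` has law `p`,
`Y` is generated from `X` by `W`, and `T` is generated from `X` by `K`. -/
def jointYT {X Y T : Type*} [Fintype X] (p : X → ℝ) (W : X → Y → ℝ) (K : X → T → ℝ) :
    Y → T → ℝ :=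
  fun y t => ∑ x, p x * W x y * K x t

/-- `K` is a representation of `X` over the finite alphabet `T` with `I(X;T) ≤ R`. -/
def IsFeasible {X T : Type*} [Fintype X] [Fintype T] (p : X → ℝ) (R : ℝ)
    (K : X → T → ℝ) : Prop :=
  IsChannel K ∧ mutualInfo (jointXT p K) ≤ R

/-- The values `I(Y;T)` of all the feasible representations, over alphabets of every finite size;
the information bottleneck function `IB(R)` is the maximum of this set. -/
def ibValues {X Y : Type*} [Fintype X] [Fintype Y] (p : X → ℝ) (W : X → Y → ℝ) (R : ℝ) :
    Set ℝ :=
  {v | ∃ (m : ℕ) (K : X → Fin m → ℝ), IsFeasible p R K ∧ mutualInfo (jointYT p W K) = v}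

/-- `K` attains the maximum in the definition of `IB(R)`. -/
def IsIBMaximizer {X Y T : Type*} [Fintype X] [Fintype Y] [Fintype T] (p : X → ℝ)
    (W : X → Y → ℝ) (R : ℝ) (K : X → T → ℝ) : Prop :=
  IsFeasible p R K ∧ IsGreatest (ibValues p W R) (mutualInfo (jointYT p W K))

/-- The uniform distribution on `X`. -/
noncomputable def uniform (X : Type*) [Fintype X] : X → ℝ :=
  fun _ => 1 / (Fintype.card X : ℝ)

/-- The `n`-ary Hamming channel with crossover probability `α`, where `n = |X|`. -/
noncomputable def hamming (X : Type*) [Fintype X] [DecidableEq X] (α : ℝ) : X → X → ℝ :=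
  fun x y => if x = y then 1 - ((Fintype.card X : ℝ) - 1) * α else α

end InfoBottleneck

namespace InfoBottleneck

open Set Filter Topology

/-! For uniform $X$, both informations are averages over the letters $t$: $I(X;T)$ averages $D(r_t)$
and $I(Y;T)$ averages $D(\text{smear } r_t)$, where $r_t$ is the posterior of $X$ and $D$ is
divergence from the uniform law. Let $l$ be the largest ratio $D(\text{smear } r)/D(r)$. Then
$I(Y;T)\le l\,I(X;T)$, with equality only if every posterior of positive mass is uniform or attains
$l$.

Near the uniform law the ratio tends to $(1-N\alpha)^2$. For $N\ge 3$ a third-order expansion shows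
that this limit is exceeded nearby (`exists_lagr_pos`), so the laws attaining $l$ stay away from the
uniform one: $D\ge\delta>0$ on them (`exists_max_ratio`). Since $D(\text{smear } r)-l\,D(r)$ is a
sum over coordinates of a function that is first concave, then convex, these laws have one heavy
letter and equal masses elsewhere (`exists_peak`).

For $R<\delta$ the value $lR$ is attained by mixing the uniform posterior with the $n$ permuted
peaks. Conversely, $R<\delta$ forces a uniform posterior in any maximizer, and since posteriors
average to the uniform law, every letter must be the heavy one of some posterior
(`exists_heavy_posterior`). That makes $n+1$ distinct letters. -/

/-! ### Divergence from the uniform law and the coordinatewise Lagrangian -/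

/-- Divergence of `r` from the uniform law with masses `1 / N`. -/
noncomputable def unifDiv {X : Type*} [Fintype X] (N : ℝ) (r : X → ℝ) : ℝ :=
  ∑ x, r x * Real.log (N * r x)

/-- The output law of the Hamming channel for the input law `r`. -/
def smear {X : Type*} (N α : ℝ) (r : X → ℝ) : X → ℝ :=
  fun x => (1 - N * α) * r x + α

/-- One coordinate's contribution to `unifDiv N (smear N α r) - l * unifDiv N r`. -/
noncomputable def lagr (N α l x : ℝ) : ℝ :=
  ((1 - N * α) * x + α) * Real.log (N * ((1 - N * α) * x + α)) - l * (x * Real.log (N * x))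

/-- The derivative of `lagr`. -/
noncomputable def lagrDeriv (N α l x : ℝ) : ℝ :=
  (1 - N * α) * (Real.log (N * ((1 - N * α) * x + α)) + 1) - l * (Real.log (N * x) + 1)

/-- The Lagrangian separates over coordinates, which reduces comparisons on the simplex to the shape
of a function of one variable. -/
theorem sum_lagr {X : Type*} [Fintype X] (N α l : ℝ) (r : X → ℝ) :
    ∑ x, lagr N α l (r x) = unifDiv N (smear N α r) - l * unifDiv N r := by
  simp only [lagr, unifDiv, smear, Finset.sum_sub_distrib, Finset.mul_sum]

theorem continuous_mul_log_const_mul {N : ℝ} (hN : N ≠ 0) :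
    Continuous fun x : ℝ => x * Real.log (N * x) := by
  have h : (fun x : ℝ => x * Real.log (N * x)) =
      fun x => N⁻¹ * ((N * x) * Real.log (N * x)) := by
    funext x; field_simp
  rw [h]
  exact continuous_const.mul (Real.continuous_mul_log.comp (continuous_const.mul continuous_id))

theorem continuous_lagr {N : ℝ} (hN : N ≠ 0) (α l : ℝ) : Continuous (lagr N α l) := by
  have h := continuous_mul_log_const_mul hN
  have h2 : Continuous fun x : ℝ => (1 - N * α) * x + α := by fun_prop
  exact (h.comp h2).sub (continuous_const.mul h)

theorem continuous_unifDiv {X : Type*} [Fintype X] {N : ℝ} (hN : N ≠ 0) :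
    Continuous (unifDiv N : (X → ℝ) → ℝ) :=
  continuous_finsetSum _ fun x _ =>
    (continuous_mul_log_const_mul hN).comp (continuous_apply x)

theorem continuous_smear {X : Type*} (N α : ℝ) :
    Continuous (smear N α : (X → ℝ) → X → ℝ) :=
  continuous_pi fun x => by unfold smear; fun_prop

/-- For $N\alpha>1$ the map is decreasing, and its smallest value on $[0,1]$ is $1-(N-1)\alpha$, at
$x=1$. -/
theorem smear_pos {N α x : ℝ} (hα : 0 < α) (hα' : (N - 1) * α < 1) (hx : x ∈ Icc (0 : ℝ) 1) :
    0 < (1 - N * α) * x + α := by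
  rcases hx.1.eq_or_lt with h | h
  · simpa [← h] using hα
  · nlinarith [mul_pos h (sub_pos.2 hα'), mul_nonneg (sub_nonneg.2 hx.2) hα.le]

theorem hasDerivAt_lagr {N α l x : ℝ} (hN : 0 < N) (hx : 0 < x)
    (hz : 0 < (1 - N * α) * x + α) : HasDerivAt (lagr N α l) (lagrDeriv N α l x) x := by
  have h1 : HasDerivAt (fun x : ℝ => (1 - N * α) * x + α) (1 - N * α) x := by
    simpa using ((hasDerivAt_id x).const_mul (1 - N * α)).add_const α
  have h2 : HasDerivAt (fun x : ℝ => N * x) N x := by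
    simpa using (hasDerivAt_id x).const_mul N
  have h3 := h1.mul ((h1.const_mul N).log (by positivity))
  have h4 := ((hasDerivAt_id x).mul (h2.log (by positivity))).const_mul l
  refine (h3.sub h4).congr_deriv ?_
  simp only [lagrDeriv, id]
  field_simp

theorem hasDerivAt_lagrDeriv {N α l x : ℝ} (hN : 0 < N) (hx : 0 < x)
    (hz : 0 < (1 - N * α) * x + α) :
    HasDerivAt (lagrDeriv N α l)
      (((1 - N * α) * (1 - N * α - l) * x - l * α) / (x * ((1 - N * α) * x + α))) x := by
  have h1 : HasDerivAt (fun x : ℝ => (1 - N * α) * x + α) (1 - N * α) x := by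
    simpa using ((hasDerivAt_id x).const_mul (1 - N * α)).add_const α
  have h2 : HasDerivAt (fun x : ℝ => N * x) N x := by
    simpa using (hasDerivAt_id x).const_mul N
  have h3 := (((h1.const_mul N).log (by positivity)).add_const 1).const_mul (1 - N * α)
  have h4 := ((h2.log (by positivity)).add_const 1).const_mul l
  refine (h3.sub h4).congr_deriv ?_
  field_simp
  ring

theorem deriv_two_lagr {N α l x : ℝ} (hN : 0 < N) (hα : 0 < α) (hα' : (N - 1) * α < 1)
    (hx : x ∈ Ioo (0 : ℝ) 1) :
    deriv^[2] (lagr N α l) x =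
      ((1 - N * α) * (1 - N * α - l) * x - l * α) / (x * ((1 - N * α) * x + α)) := by
  have h : deriv (lagr N α l) =ᶠ[𝓝 x] lagrDeriv N α l := by
    filter_upwards [Ioo_mem_nhds hx.1 hx.2] with y hy
    exact (hasDerivAt_lagr hN hy.1 (smear_pos hα hα' (Ioo_subset_Icc_self hy))).deriv
  simp only [Function.iterate_succ, Function.iterate_zero, Function.comp, id]
  rw [h.deriv_eq]
  exact (hasDerivAt_lagrDeriv hN hx.1 (smear_pos hα hα' (Ioo_subset_Icc_self hx))).deriv

/-! ### Shape of the Lagrangian and its expansion at the uniform law -/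

/-- Above the curvature ratio at the uniform law, `lagr` is strictly concave up to some point
beyond `1 / N`, and strictly convex from there on. -/
theorem exists_inflection {N α l : ℝ} (hN : 0 < N) (hN1 : 1 < N) (hα : 0 < α)
    (hα' : (N - 1) * α < 1) (hl : (1 - N * α) ^ 2 < l) :
    ∃ c, 1 / N < c ∧ StrictConcaveOn ℝ (Icc 0 1 ∩ Iic c) (lagr N α l) ∧
      StrictConvexOn ℝ (Icc 0 1 ∩ Ici c) (lagr N α l) := by
  have hl0 : 0 < l := lt_of_le_of_lt (sq_nonneg _) hl
  have key : ∃ c, 1 / N < c ∧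
      (∀ x ∈ Ioo (0 : ℝ) 1, x < c → (1 - N * α) * (1 - N * α - l) * x - l * α < 0) ∧
      (∀ x ∈ Ioo (0 : ℝ) 1, c < x → 0 < (1 - N * α) * (1 - N * α - l) * x - l * α) := by
    have hlα := mul_pos hl0 hα
    rcases le_or_gt ((1 - N * α) * (1 - N * α - l)) 0 with hA | hA
    -- The numerator is negative on all of $(0,1)$; any $c>1$ makes the convex part vacuous.
    · refine ⟨2, ?_, fun x hx _ => ?_, fun x hx h => ?_⟩
      · rw [div_lt_iff₀ hN]; linarith
      · nlinarith [mul_nonneg (neg_nonneg.2 hA) hx.1.le]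
      · linarith [hx.2]
    -- Here $c$ is the zero of the linear numerator. At $1/N$ the numerator is
    -- $((1-N\alpha)^2-l)/N<0$, so $c$ lies beyond $1/N$.
    · refine ⟨l * α / ((1 - N * α) * (1 - N * α - l)), ?_, fun x _ h => ?_, fun x _ h => ?_⟩
      · rw [div_lt_div_iff₀ hN hA]; nlinarith
      · rw [lt_div_iff₀ hA] at h; linarith
      · rw [div_lt_iff₀ hA] at h; linarith
  obtain ⟨c, hc, hlt, hgt⟩ := key
  refine ⟨c, hc, ?_, ?_⟩
  · refine strictConcaveOn_of_deriv2_neg ((convex_Icc 0 1).inter (convex_Iic c))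
      (continuous_lagr hN.ne' α l).continuousOn fun x hx => ?_
    rw [interior_inter, interior_Icc, interior_Iic] at hx
    rw [deriv_two_lagr hN hα hα' hx.1]
    exact div_neg_of_neg_of_pos (hlt x hx.1 hx.2)
      (mul_pos hx.1.1 (smear_pos hα hα' (Ioo_subset_Icc_self hx.1)))
  · refine strictConvexOn_of_deriv2_pos ((convex_Icc 0 1).inter (convex_Ici c))
      (continuous_lagr hN.ne' α l).continuousOn fun x hx => ?_
    rw [interior_inter, interior_Icc, interior_Ici] at hx
    rw [deriv_two_lagr hN hα hα' hx.1]
    exact div_pos (hgt x hx.1 hx.2)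
      (mul_pos hx.1.1 (smear_pos hα hα' (Ioo_subset_Icc_self hx.1)))

theorem lagr_one_div {N : ℝ} (hN : N ≠ 0) (α l : ℝ) : lagr N α l (1 / N) = 0 := by
  have h : N * ((1 - N * α) * (1 / N) + α) = 1 := by field_simp; ring
  rw [lagr, h, mul_one_div_cancel hN]
  simp

/-- With the curvature ratio at the uniform law as multiplier, concentrating a little mass on one
letter increases the Lagrangian. -/
theorem exists_lagr_pos {N α : ℝ} (hN : 2 < N) (hα : 0 < α) (hα0 : N * α ≠ 1) :
    ∃ s, 0 < s ∧ s < 1 / N ∧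
      0 < lagr N α ((1 - N * α) ^ 2) (1 / N + (N - 1) * s) +
        (N - 1) * lagr N α ((1 - N * α) ^ 2) (1 / N - s) := by
  have hN0 : 0 < N := by linarith
  set a := 1 - N * α with ha
  have ha0 : a ≠ 0 := fun h => hα0 (by linarith)
  have h1N : a * (1 / N) + α = 1 / N := by rw [ha]; field_simp; ring
  have hev : ∀ᶠ s in 𝓝 (0 : ℝ), s < 1 / N ∧ 0 < 1 / N + (N - 1) * s ∧
      0 < a * (1 / N + (N - 1) * s) + α ∧ 0 < a * (1 / N - s) + α ∧
      (1 / N + (N - 1) * s) * (a * (1 / N + (N - 1) * s) + α) <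
        (N - 1) ^ 2 * ((1 / N - s) * (a * (1 / N - s) + α)) := by
    have hp : 0 < 1 / N := by positivity
    refine (eventually_lt_nhds hp).and (.and ?_ (.and ?_ (.and ?_ ?_)))
    · exact ContinuousAt.eventually_lt (by fun_prop) (by fun_prop) (by simpa using hN0)
    · exact ContinuousAt.eventually_lt (by fun_prop) (by fun_prop)
        (by rw [mul_zero, add_zero, h1N]; exact hp)
    · exact ContinuousAt.eventually_lt (by fun_prop) (by fun_prop)
        (by rw [sub_zero, h1N]; exact hp)
    · refine ContinuousAt.eventually_lt (by fun_prop) (by fun_prop) ?_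
      rw [mul_zero, add_zero, sub_zero, h1N]
      have : 0 < 1 / N * (1 / N) := mul_pos hp hp
      -- This is where $N>2$ enters: for two letters the perturbation is symmetric in $s$ and the
      -- third-order term vanishes.
      have h2 : 1 < (N - 1) ^ 2 := by nlinarith
      nlinarith
  obtain ⟨δ, hδ, hball⟩ := Metric.eventually_nhds_iff.1 hev
  have hmem : ∀ s ∈ Icc 0 (δ / 2), s < 1 / N ∧ 0 < 1 / N + (N - 1) * s ∧
      0 < a * (1 / N + (N - 1) * s) + α ∧ 0 < a * (1 / N - s) + α ∧
      (1 / N + (N - 1) * s) * (a * (1 / N + (N - 1) * s) + α) <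
        (N - 1) ^ 2 * ((1 / N - s) * (a * (1 / N - s) + α)) := fun s hs =>
    hball (by rw [Real.dist_eq, sub_zero, abs_of_nonneg hs.1]; linarith [hs.2])
  have e1 : ∀ s : ℝ, HasDerivAt (fun s => 1 / N + (N - 1) * s) (N - 1) s := fun s => by
    simpa using ((hasDerivAt_id s).const_mul (N - 1)).const_add (1 / N)
  have e2 : ∀ s : ℝ, HasDerivAt (fun s => 1 / N - s) (-1) s := fun s => by
    simpa using (hasDerivAt_id s).const_sub (1 / N)
  have d1 : ∀ s ∈ Icc 0 (δ / 2), HasDerivAt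
      (fun s => lagr N α (a ^ 2) (1 / N + (N - 1) * s) + (N - 1) * lagr N α (a ^ 2) (1 / N - s))
      ((N - 1) * (lagrDeriv N α (a ^ 2) (1 / N + (N - 1) * s) -
        lagrDeriv N α (a ^ 2) (1 / N - s))) s := fun s hs => by
    obtain ⟨h1, h2, h3, h4, -⟩ := hmem s hs
    have k1 := HasDerivAt.comp s (hasDerivAt_lagr (l := a ^ 2) hN0 h2 h3) (e1 s)
    have k2 := HasDerivAt.comp s (hasDerivAt_lagr (l := a ^ 2) hN0 (sub_pos.2 h1) h4) (e2 s)
    refine (k1.add (k2.const_mul (N - 1))).congr_deriv ?_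
    ring
  have d2 : ∀ s ∈ Icc 0 (δ / 2), HasDerivAt
      (fun s => (N - 1) * (lagrDeriv N α (a ^ 2) (1 / N + (N - 1) * s) -
        lagrDeriv N α (a ^ 2) (1 / N - s)))
      ((N - 1) * (a ^ 2 * α * N * s * ((N - 1) ^ 2 /
        ((1 / N + (N - 1) * s) * (a * (1 / N + (N - 1) * s) + α)) -
          1 / ((1 / N - s) * (a * (1 / N - s) + α))))) s := fun s hs => by
    obtain ⟨h1, h2, h3, h4, -⟩ := hmem s hs
    have h1' := sub_pos.2 h1
    have k1 := HasDerivAt.comp s (hasDerivAt_lagrDeriv (l := a ^ 2) hN0 h2 h3) (e1 s)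
    have k2 := HasDerivAt.comp s (hasDerivAt_lagrDeriv (l := a ^ 2) hN0 h1' h4) (e2 s)
    refine ((k1.sub k2).const_mul (N - 1)).congr_deriv ?_
    rw [← ha]
    -- With $l=a^2$ the constant terms cancel, so both numerators are multiples of $s$ and the
    -- second derivative has the sign of the bracket, positive for small $s>0$. Two integrations
    -- from $0$ then give the claim.
    have n1 : a * (a - a ^ 2) * (1 / N + (N - 1) * s) - a ^ 2 * α =
        a ^ 2 * α * N * s * (N - 1) := by
      have : a * (a - a ^ 2) = a ^ 2 * (N * α) := by rw [ha]; ring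
      rw [this]; field_simp; ring
    have n2 : a * (a - a ^ 2) * (1 / N - s) - a ^ 2 * α = -(a ^ 2 * α * N * s) := by
      have : a * (a - a ^ 2) = a ^ 2 * (N * α) := by rw [ha]; ring
      rw [this]; field_simp; ring
    rw [n1, n2]
    ring
  have m2 : StrictMonoOn (fun s => (N - 1) * (lagrDeriv N α (a ^ 2) (1 / N + (N - 1) * s) -
        lagrDeriv N α (a ^ 2) (1 / N - s))) (Icc 0 (δ / 2)) := by
    refine strictMonoOn_of_deriv_pos (convex_Icc _ _)
      (fun s hs => (d2 s hs).continuousAt.continuousWithinAt) fun s hs => ?_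
    rw [interior_Icc] at hs
    have hs' := Ioo_subset_Icc_self hs
    rw [(d2 s hs').deriv]
    obtain ⟨h1, h2, h3, h4, h5⟩ := hmem s hs'
    have h1' := sub_pos.2 h1
    have hs0 := hs.1
    refine mul_pos (by linarith) (mul_pos (by positivity) (sub_pos.2 ?_))
    rw [div_lt_div_iff₀ (by positivity) (by positivity)]
    linarith
  have m1 : StrictMonoOn (fun s => lagr N α (a ^ 2) (1 / N + (N - 1) * s) +
      (N - 1) * lagr N α (a ^ 2) (1 / N - s)) (Icc 0 (δ / 2)) := by
    refine strictMonoOn_of_deriv_pos (convex_Icc _ _)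
      (fun s hs => (d1 s hs).continuousAt.continuousWithinAt) fun s hs => ?_
    rw [interior_Icc] at hs
    have hs' := Ioo_subset_Icc_self hs
    rw [(d1 s hs').deriv]
    have := m2 (left_mem_Icc.2 (by linarith)) hs' hs.1
    simpa using this
  have hδ2 : δ / 2 ∈ Icc 0 (δ / 2) := right_mem_Icc.2 (by linarith)
  refine ⟨δ / 2, by linarith, (hmem _ hδ2).1, ?_⟩
  have := m1 (left_mem_Icc.2 (by linarith)) hδ2 (by linarith)
  simpa [-one_div, lagr_one_div hN0.ne'] using this

/-! ### The largest divergence ratio -/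

theorem smear_const {X : Type*} {N : ℝ} (hN : N ≠ 0) (α : ℝ) :
    smear N α (fun _ : X => 1 / N) = fun _ => 1 / N := by
  funext x
  simp only [smear]
  field_simp
  ring

theorem unifDiv_const {X : Type*} [Fintype X] {N : ℝ} (hN : N ≠ 0) :
    unifDiv N (fun _ : X => 1 / N) = 0 := by
  simp [unifDiv, hN]

/-- This is $\log u<u-1$ at $u=1/(Nx)$. The left side sums to zero over a law, which gives the
strict Gibbs inequality. -/
theorem sub_one_div_lt_mul_log {N x : ℝ} (hN : 0 < N) (hx : 0 ≤ x) (h : x ≠ 1 / N) :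
    x - 1 / N < x * Real.log (N * x) := by
  rcases hx.eq_or_lt with rfl | hx
  · simpa using hN
  · have h1 : (N * x)⁻¹ ≠ 1 := fun e => h (by
      rw [inv_eq_one] at e; rw [eq_div_iff hN.ne']; linarith)
    have h2 := Real.log_lt_sub_one_of_pos (inv_pos.2 (mul_pos hN hx)) h1
    rw [Real.log_inv] at h2
    have h3 : x * (N * x)⁻¹ = 1 / N := by field_simp
    nlinarith

theorem unifDiv_pos {X : Type*} [Fintype X] {N : ℝ} (hN : 0 < N)
    (hcard : (Fintype.card X : ℝ) = N) {r : X → ℝ} (hr : r ∈ stdSimplex ℝ X)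
    (hne : ¬ ∀ x, r x = 1 / N) : 0 < unifDiv N r := by
  push Not at hne
  obtain ⟨x₀, hx₀⟩ := hne
  have h0 : ∑ x, (r x - 1 / N) = 0 := by
    rw [Finset.sum_sub_distrib, hr.2]
    simp [hcard, hN.ne']
  rw [← h0]
  refine Finset.sum_lt_sum (fun x _ => ?_) ⟨x₀, Finset.mem_univ _, ?_⟩
  · by_cases h : r x = 1 / N
    · simp [h, hN.ne']
    · exact (sub_one_div_lt_mul_log hN (hr.1 x) h).le
  · exact sub_one_div_lt_mul_log hN (hr.1 x₀) hx₀

theorem stdSimplex_le_one {X : Type*} [Fintype X] {r : X → ℝ} (hr : r ∈ stdSimplex ℝ X) (x : X) :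
    r x ∈ Icc (0 : ℝ) 1 :=
  ⟨hr.1 x, hr.2 ▸ Finset.single_le_sum (fun i _ => hr.1 i) (Finset.mem_univ x)⟩

/-- Strict Jensen on the concave part: the average coordinate is $1/N$, where `lagr` vanishes. -/
theorem sum_lagr_neg {X : Type*} [Fintype X] {N α l c : ℝ} (hN : 0 < N)
    (hcard : (Fintype.card X : ℝ) = N)
    (hc : StrictConcaveOn ℝ (Icc 0 1 ∩ Iic c) (lagr N α l)) {r : X → ℝ}
    (hr : r ∈ stdSimplex ℝ X) (hrc : ∀ x, r x ≤ c) (hne : ¬ ∀ x, r x = 1 / N) :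
    ∑ x, lagr N α l (r x) < 0 := by
  have hjk : ∃ j ∈ Finset.univ, ∃ k ∈ Finset.univ, r j ≠ r k := by
    by_contra! h
    refine hne fun x => ?_
    have : ∑ _y : X, r x = 1 := by
      rw [← hr.2]
      exact Finset.sum_congr rfl fun y _ => h x (by simp) y (by simp)
    rw [Finset.sum_const, Finset.card_univ, nsmul_eq_mul, hcard] at this
    rw [eq_div_iff hN.ne']; linarith
  have h := hc.lt_map_sum (t := Finset.univ) (w := fun _ : X => 1 / N) (p := r)
    (fun _ _ => by positivity) (by simp [hcard, hN.ne'])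
    (fun x _ => ⟨stdSimplex_le_one hr x, hrc x⟩) hjk
  simp only [smul_eq_mul, ← Finset.mul_sum, hr.2, mul_one, lagr_one_div hN.ne'] at h
  by_contra! h'
  exact absurd h (not_lt.2 (mul_nonneg (by positivity) h'))

/-- Some multiplier strictly above the curvature ratio at the uniform law is the largest value of
`unifDiv N (smear N α r) / unifDiv N r`, and it is attained only away from the uniform law. -/
theorem exists_max_ratio {X : Type*} [Fintype X] {N α : ℝ} (hN : 2 < N)
    (hcard : (Fintype.card X : ℝ) = N) (hα : 0 < α) (hα' : (N - 1) * α < 1) (hα0 : N * α ≠ 1) :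
    ∃ l δ : ℝ, (1 - N * α) ^ 2 < l ∧ 0 < δ ∧
      (∀ r ∈ stdSimplex ℝ X, unifDiv N (smear N α r) ≤ l * unifDiv N r) ∧
      (∀ r ∈ stdSimplex ℝ X, (¬ ∀ x, r x = 1 / N) →
        unifDiv N (smear N α r) = l * unifDiv N r → δ ≤ unifDiv N r) ∧
      ∃ r ∈ stdSimplex ℝ X, (¬ ∀ x, r x = 1 / N) ∧
        unifDiv N (smear N α r) = l * unifDiv N r := by
  classical
  have hN0 : 0 < N := by linarith
  have hX : Nonempty X := by
    rw [← Fintype.card_pos_iff]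
    exact_mod_cast hcard ▸ hN0
  obtain ⟨i₀⟩ := hX
  obtain ⟨s, hs0, hs1, hs⟩ := exists_lagr_pos hN hα hα0
  set r₀ : X → ℝ := fun x => if x = i₀ then 1 / N + (N - 1) * s else 1 / N - s with hr₀
  have hsum : ∀ F : ℝ → ℝ, ∑ x, F (r₀ x) =
      F (1 / N + (N - 1) * s) + (N - 1) * F (1 / N - s) := fun F => by
    rw [← Finset.add_sum_erase _ _ (Finset.mem_univ i₀), Finset.sum_congr rfl
      (g := fun _ => F (1 / N - s)) fun x hx => by simp [hr₀, (Finset.mem_erase.1 hx).1]]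
    have h1 : 1 ≤ Fintype.card X := Fintype.card_pos_iff.2 ⟨i₀⟩
    rw [Finset.sum_const, Finset.card_erase_of_mem (Finset.mem_univ _), Finset.card_univ,
      nsmul_eq_mul, Nat.cast_sub h1, hcard]
    simp [hr₀]
  have hr₀s : r₀ ∈ stdSimplex ℝ X := by
    refine ⟨fun x => ?_, ?_⟩
    · simp only [hr₀]
      split_ifs
      · have : 0 < N - 1 := by linarith
        positivity
      · linarith
    · have := hsum id
      simp only [id] at this
      rw [this]
      field_simp
      ring
  have hr₀n : ¬ ∀ x, r₀ x = 1 / N := fun h => by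
    have h1 := h i₀
    have h2 : 0 < (N - 1) * s := mul_pos (by linarith) hs0
    simp only [hr₀, if_true] at h1
    linarith
  rw [← hsum, sum_lagr, sub_pos] at hs
  have hf₀ := unifDiv_pos hN0 hcard hr₀s hr₀n
  set l₀ := unifDiv N (smear N α r₀) / unifDiv N r₀ with hl₀
  have hl₀' : (1 - N * α) ^ 2 < l₀ := (lt_div_iff₀ hf₀).2 hs
  obtain ⟨c, hc, hconc, -⟩ := exists_inflection hN0 (by linarith) hα hα' hl₀'
  -- `S` is compact and, as $c>1/N$, misses the uniform law. Outside `S` Jensen keeps the ratio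
  -- below `l₀`, so the maximum over `S` is global, and the minimum of `unifDiv` over `S` serves as
  -- $\delta$.
  set S : Set (X → ℝ) := stdSimplex ℝ X ∩ {r | ∃ x, c ≤ r x} with hS
  have hnear : ∀ r ∈ stdSimplex ℝ X, r ∉ S → (¬ ∀ x, r x = 1 / N) →
      unifDiv N (smear N α r) < l₀ * unifDiv N r := fun r hr hrS hne => by
    have := sum_lagr_neg hN0 hcard hconc hr (fun x => not_lt.1 fun h => hrS ⟨hr, x, h.le⟩) hne
    rw [sum_lagr] at this
    linarith
  have hr₀S : r₀ ∈ S := by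
    by_contra h
    have := hnear r₀ hr₀s h hr₀n
    rw [hl₀, div_mul_cancel₀ _ hf₀.ne'] at this
    exact lt_irrefl _ this
  have hScomp : IsCompact S := by
    refine (isCompact_stdSimplex ℝ X).inter_right ?_
    have : {r : X → ℝ | ∃ x, c ≤ r x} = ⋃ x, {r : X → ℝ | c ≤ r x} := by ext; simp
    rw [this]
    exact isClosed_iUnion_of_finite fun x => isClosed_le continuous_const (continuous_apply x)
  have hSn : ∀ r ∈ S, ¬ ∀ x, r x = 1 / N := fun r hr h => by
    obtain ⟨-, x, hx⟩ := hr
    rw [h x] at hx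
    linarith
  have hSpos : ∀ r ∈ S, 0 < unifDiv N r := fun r hr => unifDiv_pos hN0 hcard hr.1 (hSn r hr)
  have hcf : ContinuousOn (unifDiv N : (X → ℝ) → ℝ) S :=
    (continuous_unifDiv hN0.ne').continuousOn
  have hcg : ContinuousOn (fun r : X → ℝ => unifDiv N (smear N α r)) S :=
    ((continuous_unifDiv hN0.ne').comp (continuous_smear N α)).continuousOn
  obtain ⟨r₁, hr₁, hmax⟩ := hScomp.exists_isMaxOn ⟨r₀, hr₀S⟩
    (hcg.div hcf fun r hr => (hSpos r hr).ne')
  obtain ⟨r₂, hr₂, hmin⟩ := hScomp.exists_isMinOn ⟨r₀, hr₀S⟩ hcf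
  set l := unifDiv N (smear N α r₁) / unifDiv N r₁ with hl
  have hll : l₀ ≤ l := hmax hr₀S
  have hfnn : ∀ r ∈ stdSimplex ℝ X, (¬ ∀ x, r x = 1 / N) → 0 < unifDiv N r := fun r hr =>
    unifDiv_pos hN0 hcard hr
  have hout : ∀ r ∈ stdSimplex ℝ X, r ∉ S → (¬ ∀ x, r x = 1 / N) →
      unifDiv N (smear N α r) < l * unifDiv N r := fun r hr hrS hne =>
    (hnear r hr hrS hne).trans_le (mul_le_mul_of_nonneg_right hll (hfnn r hr hne).le)
  refine ⟨l, unifDiv N r₂, hl₀'.trans_le hll, hSpos r₂ hr₂, fun r hr => ?_, fun r hr hne he => ?_,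
    r₁, hr₁.1, hSn r₁ hr₁, ?_⟩
  · by_cases hrS : r ∈ S
    · exact (div_le_iff₀ (hSpos r hrS)).1 (hmax hrS)
    · by_cases hne : ∀ x, r x = 1 / N
      · obtain rfl : r = fun _ => 1 / N := funext hne
        rw [smear_const hN0.ne', unifDiv_const hN0.ne', mul_zero]
      · exact (hout r hr hrS hne).le
  · by_cases hrS : r ∈ S
    · exact hmin hrS
    · exact absurd he (hout r hr hrS hne).ne
  · rw [hl, div_mul_cancel₀ _ (hSpos r₁ hr₁).ne']

/-! ### Shape of the laws attaining the largest ratio -/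

/-- A law attaining $l$ maximizes the separable Lagrangian over the simplex, so moving mass between
two letters cannot increase it. -/
theorem lagr_pair_le {X : Type*} [Fintype X] {N α l : ℝ}
    (hmax : ∀ r ∈ stdSimplex ℝ X, unifDiv N (smear N α r) ≤ l * unifDiv N r) {r : X → ℝ}
    (hr : r ∈ stdSimplex ℝ X) (he : unifDiv N (smear N α r) = l * unifDiv N r) {j k : X}
    (hjk : j ≠ k) {p q : ℝ} (hp : 0 ≤ p) (hq : 0 ≤ q) (hpq : p + q = r j + r k) :
    lagr N α l p + lagr N α l q ≤ lagr N α l (r j) + lagr N α l (r k) := by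
  classical
  set r' : X → ℝ := fun x => if x = j then p else if x = k then q else r x with hr'
  have hsum : ∀ F : ℝ → ℝ, ∑ x, F (r' x) - ∑ x, F (r x) =
      (F p - F (r j)) + (F q - F (r k)) := fun F => by
    rw [← Finset.sum_sub_distrib, Fintype.sum_eq_add j k hjk]
    · simp [hr', hjk.symm]
    · rintro x ⟨h1, h2⟩
      simp [hr', h1, h2]
  have hr's : r' ∈ stdSimplex ℝ X := by
    refine ⟨fun x => ?_, ?_⟩
    · simp only [hr']
      split_ifs
      exacts [hp, hq, hr.1 x]
    · have := hsum id
      simp only [id, hr.2] at this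
      linarith
  have h1 := hsum (lagr N α l)
  have h2 := hmax r' hr's
  rw [sum_lagr, sum_lagr, he] at h1
  linarith

/-- A non-uniform law with the largest ratio has one heavy letter, and gives equal masses to the
others. -/
theorem exists_peak {X : Type*} [Fintype X] {N α l : ℝ} (hN : 1 < N)
    (hcard : (Fintype.card X : ℝ) = N) (hα : 0 < α) (hα' : (N - 1) * α < 1)
    (hl : (1 - N * α) ^ 2 < l)
    (hmax : ∀ r ∈ stdSimplex ℝ X, unifDiv N (smear N α r) ≤ l * unifDiv N r) {r : X → ℝ}
    (hr : r ∈ stdSimplex ℝ X) (hne : ¬ ∀ x, r x = 1 / N)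
    (he : unifDiv N (smear N α r) = l * unifDiv N r) :
    ∃ i z, (∀ j, j ≠ i → r j = z) ∧ z < 1 / N ∧ 1 / N < r i := by
  classical
  have hN0 : 0 < N := by linarith
  obtain ⟨c, hc, hconc, hconv⟩ := exists_inflection hN0 hN hα hα' hl
  have hbig : ∃ i, c < r i := by
    by_contra! h
    have := sum_lagr_neg hN0 hcard hconc hr h hne
    rw [sum_lagr] at this
    linarith
  obtain ⟨i, hi⟩ := hbig
  have hpair : ∀ j, j ≠ i → r j + r i ≤ 1 := fun j hj => by
    rw [← hr.2, ← Finset.sum_pair hj]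
    exact Finset.sum_le_sum_of_subset_of_nonneg (Finset.subset_univ _) fun x _ _ => hr.1 x
  have hc0 : 0 < c := lt_trans (by positivity) hc
  -- Two letters above $c$ could be spread apart, one down to $c$ and the other taking the
  -- difference; strict convexity would raise the Lagrangian.
  have hsmall : ∀ j, j ≠ i → r j ≤ c := fun j hj => by
    by_contra! hjc
    have h1 := lagr_pair_le hmax hr he hj hc0.le
      (show 0 ≤ r j + r i - c by linarith) (add_sub_cancel c _)
    have hcm : c ∈ Icc (0 : ℝ) 1 ∩ Ici c :=
      ⟨⟨hc0.le, hjc.le.trans (stdSimplex_le_one hr j).2⟩, le_refl c⟩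
    have hem : r j + r i - c ∈ Icc (0 : ℝ) 1 ∩ Ici c :=
      ⟨⟨by linarith, by linarith [hpair j hj]⟩, by simp only [mem_Ici]; linarith⟩
    set D := r j + r i - 2 * c with hD
    have hDpos : 0 < D := by rw [hD]; linarith
    have hw1 : 0 < (r i - c) / D := div_pos (by linarith) hDpos
    have hw2 : 0 < (r j - c) / D := div_pos (by linarith) hDpos
    have hws : (r i - c) / D + (r j - c) / D = 1 := by
      rw [← add_div, div_eq_one_iff_eq hDpos.ne']; rw [hD]; ring
    have hce : c ≠ r j + r i - c := by intro h; rw [hD] at hDpos; linarith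
    have k1 := hconv.2 hcm hem hce hw1 hw2 hws
    have k2 := hconv.2 hcm hem hce hw2 hw1 (by linarith)
    simp only [smul_eq_mul] at k1 k2
    have e1 : (r i - c) / D * c + (r j - c) / D * (r j + r i - c) = r j := by
      field_simp; rw [hD]; ring
    have e2 : (r j - c) / D * c + (r i - c) / D * (r j + r i - c) = r i := by
      field_simp; rw [hD]; ring
    rw [e1] at k1
    rw [e2] at k2
    have e3 : ∀ u v : ℝ, (r i - c) / D * u + (r j - c) / D * v +
        ((r j - c) / D * u + (r i - c) / D * v) = u + v := fun u v => by
      linear_combination (u + v) * hws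
    linarith [e3 (lagr N α l c) (lagr N α l (r j + r i - c))]
  -- The remaining masses lie on the concave side, where averaging two different ones would raise
  -- the Lagrangian.
  have heq : ∀ j, j ≠ i → ∀ k, k ≠ i → r j = r k := fun j hj k hk => by
    by_contra hjk
    have hjk' : j ≠ k := fun h => hjk (by rw [h])
    have h0 : 0 ≤ (r j + r k) / 2 := by linarith [hr.1 j, hr.1 k]
    have h1 := lagr_pair_le hmax hr he hjk' h0 h0 (by ring)
    have h2 := hconc.2 ⟨stdSimplex_le_one hr j, hsmall j hj⟩ ⟨stdSimplex_le_one hr k, hsmall k hk⟩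
      hjk (show (0 : ℝ) < 1 / 2 by norm_num) (show (0 : ℝ) < 1 / 2 by norm_num) (by norm_num)
    simp only [smul_eq_mul] at h2
    rw [show 1 / 2 * r j + 1 / 2 * r k = (r j + r k) / 2 by ring] at h2
    linarith
  have hji : ∃ j, j ≠ i := by
    have : 1 < Fintype.card X := by exact_mod_cast hcard ▸ hN
    obtain ⟨j, hj⟩ := Fintype.exists_ne_of_one_lt_card this i
    exact ⟨j, hj⟩
  obtain ⟨j, hj⟩ := hji
  have hz : ∀ k, k ≠ i → r k = r j := fun k hk => heq k hk j hj
  refine ⟨i, r j, hz, ?_, hc.trans hi⟩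
  have h1 : ∑ x, (r x - 1 / N) = 0 := by
    rw [Finset.sum_sub_distrib, hr.2]
    simp [hcard, hN0.ne']
  by_contra! h
  have h2 : 0 < ∑ x, (r x - 1 / N) := by
    refine Finset.sum_pos' (fun x _ => ?_) ⟨i, Finset.mem_univ _, by linarith⟩
    by_cases hx : x = i
    · rw [hx]; linarith
    · rw [hz x hx]; linarith
  exact h2.ne' h1

/-! ### Mutual informations as averages over posteriors -/

/-- The conditional law of the input given the letter `t`, for a uniform input. -/
noncomputable def posterior {X T : Type*} [Fintype X] (K : X → T → ℝ) (t : T) : X → ℝ :=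
  fun x => K x t / ∑ x', K x' t

theorem posterior_mem_stdSimplex {X T : Type*} [Fintype X] [Fintype T] {K : X → T → ℝ}
    (hK : IsChannel K) {t : T} (ht : 0 < ∑ x, K x t) : posterior K t ∈ stdSimplex ℝ X :=
  ⟨fun x => div_nonneg ((hK x).1 t) ht.le, by
    simp only [posterior]
    rw [← Finset.sum_div, div_self ht.ne']⟩

theorem sum_mass {X T : Type*} [Fintype X] [Fintype T] [Nonempty X] {K : X → T → ℝ}
    (hK : IsChannel K) : ∑ t, (∑ x, K x t) / (Fintype.card X : ℝ) = 1 := by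
  rw [← Finset.sum_div, Finset.sum_comm, Finset.sum_congr rfl fun x _ => (hK x).2]
  simp

/-- The letter `t` has probability $\sum_x K(x,t)/N$. A letter of mass zero has posterior $0/0=0$
and contributes nothing to either side. -/
theorem mutualInfo_jointXT {X T : Type*} [Fintype X] [Fintype T] [Nonempty X] {K : X → T → ℝ}
    (hK : IsChannel K) :
    mutualInfo (jointXT (uniform X) K) =
      ∑ t, (∑ x, K x t) / (Fintype.card X : ℝ) * unifDiv (Fintype.card X) (posterior K t) := by
  have hN : (Fintype.card X : ℝ) ≠ 0 := by simp
  rw [mutualInfo, Finset.sum_comm]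
  refine Finset.sum_congr rfl fun t _ => ?_
  rw [unifDiv, Finset.mul_sum]
  refine Finset.sum_congr rfl fun x _ => ?_
  simp only [jointXT, uniform, posterior, ← Finset.mul_sum, (hK x).2, mul_one]
  by_cases hS : ∑ x', K x' t = 0
  · rw [(Finset.sum_eq_zero_iff_of_nonneg fun y _ => (hK y).1 t).1 hS x (Finset.mem_univ x)]
    simp
  · have h : 1 / (Fintype.card X : ℝ) * K x t /
        (1 / (Fintype.card X : ℝ) * (1 / (Fintype.card X : ℝ) * ∑ x', K x' t)) =
        Fintype.card X * (K x t / ∑ x', K x' t) := by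
      field_simp
    rw [h]
    field_simp

/-- The channel from `Y` to `T` in the chain `Y - X - T`, for a uniform input and the Hamming
channel. -/
def throughHamming {X T : Type*} [Fintype X] (α : ℝ) (K : X → T → ℝ) : X → T → ℝ :=
  fun y t => (1 - Fintype.card X * α) * K y t + α * ∑ x, K x t

/-- The Hamming matrix is symmetric and preserves the uniform law, so it is its own reverse channel.
Thus $(Y,T)$ again has a uniform first marginal, and the formula for $I(X;T)$ applies to it. -/
theorem jointYT_hamming {X T : Type*} [Fintype X] [DecidableEq X] (α : ℝ) (K : X → T → ℝ) :
    jointYT (uniform X) (hamming X α) K = jointXT (uniform X) (throughHamming α K) := by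
  funext y t
  have h : ∀ x, hamming X α x y =
      α + if x = y then 1 - (Fintype.card X : ℝ) * α else 0 := fun x => by
    unfold hamming
    split_ifs <;> ring
  simp only [jointYT, jointXT, uniform, throughHamming, h, mul_assoc, add_mul, ite_mul, zero_mul]
  rw [← Finset.mul_sum, Finset.sum_add_distrib, ← Finset.mul_sum]
  simp
  exact Or.inl (by ring)

theorem sum_throughHamming {X T : Type*} [Fintype X] (α : ℝ) (K : X → T → ℝ) (t : T) :
    ∑ x, throughHamming α K x t = ∑ x, K x t := by
  simp only [throughHamming]
  rw [Finset.sum_add_distrib, ← Finset.mul_sum]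
  simp
  ring

theorem isChannel_throughHamming {X T : Type*} [Fintype X] [Fintype T] {α : ℝ} {K : X → T → ℝ}
    (hK : IsChannel K) (hα : 0 < α) (hα' : ((Fintype.card X : ℝ) - 1) * α < 1) :
    IsChannel (throughHamming α K) := fun y => by
  refine ⟨fun t => ?_, ?_⟩
  · have h1 : K y t ≤ ∑ x, K x t :=
      Finset.single_le_sum (f := fun x => K x t) (fun x _ => (hK x).1 t) (Finset.mem_univ y)
    have h2 := (hK y).1 t
    simp only [throughHamming]
    nlinarith [mul_nonneg (sub_nonneg.2 hα'.le) h2, mul_nonneg hα.le (sub_nonneg.2 h1)]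
  · simp only [throughHamming]
    rw [Finset.sum_add_distrib, ← Finset.mul_sum, ← Finset.mul_sum, Finset.sum_comm, (hK y).2,
      Finset.sum_congr rfl fun x _ => (hK x).2]
    simp
    ring

theorem posterior_throughHamming {X T : Type*} [Fintype X] (α : ℝ) {K : X → T → ℝ} {t : T}
    (ht : ∑ x, K x t ≠ 0) :
    posterior (throughHamming α K) t = smear (Fintype.card X) α (posterior K t) := by
  funext x
  simp only [posterior, sum_throughHamming]
  simp only [smear, throughHamming, posterior]
  field_simp

theorem mutualInfo_jointYT {X T : Type*} [Fintype X] [DecidableEq X] [Fintype T] [Nonempty X]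
    {α : ℝ} {K : X → T → ℝ} (hK : IsChannel K) (hα : 0 < α)
    (hα' : ((Fintype.card X : ℝ) - 1) * α < 1) :
    mutualInfo (jointYT (uniform X) (hamming X α) K) =
      ∑ t, (∑ x, K x t) / (Fintype.card X : ℝ) *
        unifDiv (Fintype.card X) (smear (Fintype.card X) α (posterior K t)) := by
  rw [jointYT_hamming, mutualInfo_jointXT (isChannel_throughHamming hK hα hα')]
  refine Finset.sum_congr rfl fun t _ => ?_
  rw [sum_throughHamming]
  by_cases ht : ∑ x, K x t = 0
  · simp [ht]
  · rw [posterior_throughHamming α ht]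

theorem mutualInfo_jointYT_le {X T : Type*} [Fintype X] [DecidableEq X] [Fintype T] [Nonempty X]
    {α l : ℝ} {K : X → T → ℝ} (hK : IsChannel K) (hα : 0 < α)
    (hα' : ((Fintype.card X : ℝ) - 1) * α < 1)
    (hmax : ∀ r ∈ stdSimplex ℝ X,
      unifDiv (Fintype.card X) (smear (Fintype.card X) α r) ≤ l * unifDiv (Fintype.card X) r) :
    mutualInfo (jointYT (uniform X) (hamming X α) K) ≤
      l * mutualInfo (jointXT (uniform X) K) := by
  rw [mutualInfo_jointYT hK hα hα', mutualInfo_jointXT hK, Finset.mul_sum]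
  refine Finset.sum_le_sum fun t _ => ?_
  have h0 : 0 ≤ ∑ x, K x t := Finset.sum_nonneg fun x _ => (hK x).1 t
  rcases h0.eq_or_lt with h | h
  · simp [← h]
  · rw [mul_left_comm]
    exact mul_le_mul_of_nonneg_left (hmax _ (posterior_mem_stdSimplex hK h)) (by positivity)

/-- When the largest ratio is attained by the pair of informations, every letter of positive mass
attains it. -/
theorem posterior_ratio_eq {X T : Type*} [Fintype X] [DecidableEq X] [Fintype T] [Nonempty X]
    {α l : ℝ} {K : X → T → ℝ} (hK : IsChannel K) (hα : 0 < α)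
    (hα' : ((Fintype.card X : ℝ) - 1) * α < 1)
    (hmax : ∀ r ∈ stdSimplex ℝ X,
      unifDiv (Fintype.card X) (smear (Fintype.card X) α r) ≤ l * unifDiv (Fintype.card X) r)
    (he : l * mutualInfo (jointXT (uniform X) K) ≤
      mutualInfo (jointYT (uniform X) (hamming X α) K)) {t : T} (ht : 0 < ∑ x, K x t) :
    unifDiv (Fintype.card X) (smear (Fintype.card X) α (posterior K t)) =
      l * unifDiv (Fintype.card X) (posterior K t) := by
  refine le_antisymm (hmax _ (posterior_mem_stdSimplex hK ht)) ?_
  by_contra! hlt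
  refine he.not_gt ?_
  rw [mutualInfo_jointYT hK hα hα', mutualInfo_jointXT hK, Finset.mul_sum]
  refine Finset.sum_lt_sum (fun t _ => ?_) ⟨t, Finset.mem_univ _, ?_⟩
  · have h0 : 0 ≤ ∑ x, K x t := Finset.sum_nonneg fun x _ => (hK x).1 t
    rcases h0.eq_or_lt with h | h
    · simp [← h]
    · rw [mul_left_comm]
      exact mul_le_mul_of_nonneg_left (hmax _ (posterior_mem_stdSimplex hK h)) (by positivity)
  · rw [mul_left_comm]
    exact mul_lt_mul_of_pos_left hlt (by positivity)

/-! ### The channel on $n+1$ letters -/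

/-- The channel that reveals nothing with probability `1 - w`, and otherwise draws a letter of `X`
that is the input with probability `y`, and any other given letter with probability `z`. -/
def peakChannel {X : Type*} [DecidableEq X] (w y z : ℝ) : X → Option X → ℝ :=
  fun x t => t.elim (1 - w) fun i => w * if x = i then y else z

theorem sum_ite_eq_peak {X : Type*} [Fintype X] [DecidableEq X] (i : X) (y z : ℝ) :
    ∑ x, (if x = i then y else z) = y + (Fintype.card X - 1) * z := by
  have : ∀ x : X, (if x = i then y else z) = z + if x = i then y - z else 0 := fun x => by
    split_ifs <;> ring
  simp only [this, Finset.sum_add_distrib]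
  simp
  ring

theorem isChannel_peakChannel {X : Type*} [Fintype X] [DecidableEq X] {w y z : ℝ} (hw0 : 0 ≤ w)
    (hw1 : w ≤ 1) (hy : 0 ≤ y) (hz : 0 ≤ z) (hyz : y + (Fintype.card X - 1) * z = 1) :
    IsChannel (peakChannel w y z : X → Option X → ℝ) := fun x => by
  refine ⟨fun t => ?_, ?_⟩
  · cases t with
    | none => exact sub_nonneg.2 hw1
    | some i =>
      refine mul_nonneg hw0 ?_
      split_ifs <;> assumption
  · rw [Fintype.sum_option]
    simp only [peakChannel, Option.elim, ← Finset.mul_sum, eq_comm (a := x)]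
    rw [sum_ite_eq_peak, hyz]
    ring

theorem mutualInfo_comp_equiv {A B B' : Type*} [Fintype A] [Fintype B] [Fintype B'] (e : B' ≃ B)
    (q : A → B → ℝ) : mutualInfo (fun a b => q a (e b)) = mutualInfo q := by
  unfold mutualInfo
  refine Finset.sum_congr rfl fun a _ => ?_
  rw [e.sum_comp (q a)]
  exact e.sum_comp fun b => q a b * Real.log (q a b / ((∑ b', q a b') * ∑ a', q a' b))

/-- The weighted sum of a functional over the posteriors of `peakChannel`. -/
theorem sum_peakChannel {X : Type*} [Fintype X] [DecidableEq X] [Nonempty X] {w y z v : ℝ}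
    (hw0 : w ≠ 0) (hw1 : w ≠ 1) (hyz : y + (Fintype.card X - 1) * z = 1) (G : (X → ℝ) → ℝ)
    (h0 : G (fun _ => 1 / Fintype.card X) = 0) (hG : ∀ i, G (fun x => if x = i then y else z) = v) :
    ∑ t, (∑ x, (peakChannel w y z : X → Option X → ℝ) x t) / (Fintype.card X : ℝ) *
      G (posterior (peakChannel w y z) t) = w * v := by
  have hN : (Fintype.card X : ℝ) ≠ 0 := by simp
  have hs : ∀ i, ∑ x, (peakChannel w y z : X → Option X → ℝ) x (some i) = w := fun i => by
    simp only [peakChannel, Option.elim, ← Finset.mul_sum]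
    rw [sum_ite_eq_peak, hyz, mul_one]
  have hp0 : posterior (peakChannel w y z : X → Option X → ℝ) none =
      fun _ => 1 / (Fintype.card X : ℝ) := by
    funext x
    have := sub_ne_zero.2 hw1.symm
    simp [posterior, peakChannel]
    field_simp
  have hp : ∀ i, posterior (peakChannel w y z : X → Option X → ℝ) (some i) =
      fun x => if x = i then y else z := fun i => by
    funext x
    simp only [posterior, hs]
    simp only [peakChannel, Option.elim]
    field_simp
  rw [Fintype.sum_option]
  simp only [hs, hp, hp0, h0, hG]
  simp
  field_simp

theorem unifDiv_peak {X : Type*} [Fintype X] [DecidableEq X] (N : ℝ) (i : X) (y z : ℝ) :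
    unifDiv N (fun x => if x = i then y else z) =
      y * Real.log (N * y) + (Fintype.card X - 1) * (z * Real.log (N * z)) := by
  rw [← sum_ite_eq_peak i, unifDiv]
  exact Finset.sum_congr rfl fun x _ => by split_ifs <;> rfl

theorem smear_peak {X : Type*} [DecidableEq X] (N α : ℝ) (i : X) (y z : ℝ) :
    smear N α (fun x => if x = i then y else z) =
      fun x => if x = i then (1 - N * α) * y + α else (1 - N * α) * z + α := by
  funext x
  simp only [smear]
  split_ifs <;> rfl

/-! ### Counting the letters of a maximizer -/

/-- If every posterior is uniform or has a single heavy letter, and the information is positive,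
then every letter of `X` is the heavy one of some posterior. -/
theorem exists_heavy_posterior {X T : Type*} [Fintype X] [Fintype T] [Nonempty X] {K : X → T → ℝ}
    (hK : IsChannel K) (hpos : 0 < mutualInfo (jointXT (uniform X) K))
    (hp : ∀ t, 0 < ∑ x, K x t → (∀ x, posterior K t x = 1 / (Fintype.card X : ℝ)) ∨
      ∃ i z, (∀ j, j ≠ i → posterior K t j = z) ∧ z < 1 / (Fintype.card X : ℝ) ∧
        1 / (Fintype.card X : ℝ) < posterior K t i) (x : X) :
    ∃ t, 0 < ∑ x', K x' t ∧ 1 / (Fintype.card X : ℝ) < posterior K t x := by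
  have hN : (0 : ℝ) < Fintype.card X := by exact_mod_cast Fintype.card_pos
  have hS : ∀ t, 0 ≤ ∑ x', K x' t := fun t => Finset.sum_nonneg fun x _ => (hK x).1 t
  -- The posteriors average to the uniform law. If none gives `x` more than $1/N$, all those of
  -- positive mass give it exactly $1/N$. A peaked law gives no letter mass $1/N$, so they are all
  -- uniform and the information is zero.
  by_contra! h
  have h0 : ∑ t, (∑ x', K x' t) / (Fintype.card X : ℝ) *
      (1 / (Fintype.card X : ℝ) - posterior K t x) = 0 := by
    have e : ∀ t, (∑ x', K x' t) / (Fintype.card X : ℝ) * posterior K t x =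
        K x t / Fintype.card X := fun t => by
      by_cases ht : ∑ x', K x' t = 0
      · rw [(Finset.sum_eq_zero_iff_of_nonneg fun y _ => (hK y).1 t).1 ht x (Finset.mem_univ x)]
        simp [ht]
      · simp only [posterior]
        field_simp
    simp only [mul_sub, Finset.sum_sub_distrib, e]
    rw [← Finset.sum_mul, sum_mass hK, ← Finset.sum_div, (hK x).2]
    ring
  rw [Finset.sum_eq_zero_iff_of_nonneg] at h0
  · refine hpos.ne' ?_
    rw [mutualInfo_jointXT hK]
    refine Finset.sum_eq_zero fun t _ => ?_
    rcases (hS t).eq_or_lt with ht | ht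
    · simp [← ht]
    · have hx : posterior K t x = 1 / (Fintype.card X : ℝ) := by
        have := (mul_eq_zero.1 (h0 t (Finset.mem_univ t))).resolve_left (by positivity)
        linarith
      rcases hp t ht with hu | ⟨i, z, hz, hz1, hi⟩
      · rw [funext hu, unifDiv_const hN.ne', mul_zero]
      · by_cases hxi : x = i
        · rw [← hxi] at hi
          linarith
        · rw [hz x hxi] at hx
          linarith
  · intro t _
    rcases (hS t).eq_or_lt with ht | ht
    · simp [← ht]
    · exact mul_nonneg (by positivity) (sub_nonneg.2 (h t ht))

/-- One letter with the uniform posterior, and one for each heavy letter of `X`. -/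
theorem card_add_one_le {X T : Type*} [Fintype X] [Fintype T] {K : X → T → ℝ}
    (hp : ∀ t, 0 < ∑ x, K x t → (∀ x, posterior K t x = 1 / (Fintype.card X : ℝ)) ∨
      ∃ i z, (∀ j, j ≠ i → posterior K t j = z) ∧ z < 1 / (Fintype.card X : ℝ) ∧
        1 / (Fintype.card X : ℝ) < posterior K t i)
    (h0 : ∃ t, ∀ x, posterior K t x = 1 / (Fintype.card X : ℝ))
    (h1 : ∀ x, ∃ t, 0 < ∑ x', K x' t ∧ 1 / (Fintype.card X : ℝ) < posterior K t x) :
    Fintype.card X + 1 ≤ Fintype.card T := by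
  obtain ⟨t₀, ht₀⟩ := h0
  choose τ hτ hτx using h1
  rw [← Fintype.card_option]
  refine Fintype.card_le_of_injective (fun o : Option X => o.elim t₀ τ) ?_
  have hne : ∀ x, τ x ≠ t₀ := fun x h => by
    have := hτx x
    rw [h, ht₀ x] at this
    exact lt_irrefl _ this
  have hinj : ∀ x x', τ x = τ x' → x = x' := fun x x' h => by
    have k1 := hτx x
    have k2 := hτx x'
    rw [← h] at k2
    rcases hp _ (hτ x) with hu | ⟨i, z, hz, hz1, -⟩
    · rw [hu x] at k1
      exact absurd k1 (lt_irrefl _)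
    · have e : ∀ u, 1 / (Fintype.card X : ℝ) < posterior K (τ x) u → u = i := fun u hu => by
        by_contra hne
        rw [hz u hne] at hu
        exact lt_asymm hu hz1
      rw [e x k1, e x' k2]
  intro o o' h
  cases o <;> cases o'
  · rfl
  · exact absurd h.symm (hne _)
  · exact absurd h (hne _)
  · exact congrArg some (hinj _ _ h)

end InfoBottleneck
-- The theorem
open InfoBottleneck in
theorem theorem3 {X : Type*} [Fintype X] [DecidableEq X] (n : ℕ)
    (hcard : Fintype.card X = n) (hn : 3 ≤ n) (α : ℝ)
    (hα : α ∈ Set.Ioo (0 : ℝ) (1 / (n : ℝ)) ∪ Set.Ioo (1 / (n : ℝ)) (1 / ((n : ℝ) - 1))) :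
    ∃ Rc : ℝ, 0 < Rc ∧ Rc < Real.log n ∧ ∀ R : ℝ, 0 < R → R < Rc →
      (∀ (T : Type*) [Fintype T] (K : X → T → ℝ),
        InfoBottleneck.IsIBMaximizer (InfoBottleneck.uniform X)
          (InfoBottleneck.hamming X α) R K → n + 1 ≤ Fintype.card T) ∧
      (∃ K : X → Fin (n + 1) → ℝ,
        InfoBottleneck.IsIBMaximizer (InfoBottleneck.uniform X)
          (InfoBottleneck.hamming X α) R K) := by
  subst hcard
  have hN : (2 : ℝ) < Fintype.card X := by exact_mod_cast hn
  have hN0 : (0 : ℝ) < Fintype.card X := by linarith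
  have hX : Nonempty X := Fintype.card_pos_iff.1 (by omega)
  obtain ⟨hα0, hα', hαN⟩ : 0 < α ∧ ((Fintype.card X : ℝ) - 1) * α < 1 ∧
      (Fintype.card X : ℝ) * α ≠ 1 := by
    rcases hα with ⟨h1, h2⟩ | ⟨h1, h2⟩
    · rw [lt_div_iff₀ hN0] at h2
      exact ⟨h1, by linarith, by linarith⟩
    · rw [lt_div_iff₀ (by linarith)] at h2
      rw [div_lt_iff₀ hN0] at h1
      exact ⟨by by_contra! h; nlinarith, by linarith, by linarith⟩
  obtain ⟨l, δ, hl, hδ, hmax, hmin, r, hr, hrn, hre⟩ :=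
    exists_max_ratio (X := X) hN rfl hα0 hα' hαN
  have hl0 : 0 < l := (sq_nonneg _).trans_lt hl
  have hpeak := fun {r : X → ℝ} => exists_peak (r := r) (by linarith) rfl hα0 hα' hl hmax
  have hlog : 0 < Real.log (Fintype.card X) := Real.log_pos (by linarith)
  -- The second term serves only to make $R_c<\log n$ strict.
  refine ⟨min δ (Real.log (Fintype.card X) / 2), lt_min hδ (by linarith),
    (min_le_right _ _).trans_lt (by linarith), fun R hR hRc => ?_⟩
  have hRδ : R < δ := hRc.trans_le (min_le_left _ _)
  obtain ⟨i, z, hz, -, -⟩ := hpeak hr hrn hre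
  have hri : r = fun x => if x = i then r i else z := by
    funext x
    split_ifs with h
    · rw [h]
    · exact hz x h
  obtain ⟨j, hj⟩ := Fintype.exists_ne_of_one_lt_card (show 1 < Fintype.card X by omega) i
  have hz0 : 0 ≤ z := hz j hj ▸ hr.1 j
  have hyz : r i + (Fintype.card X - 1) * z = 1 := by
    rw [← sum_ite_eq_peak i, ← hr.2]
    exact Finset.sum_congr rfl fun x _ => (congrFun hri x).symm
  have hFδ : δ ≤ unifDiv (Fintype.card X) r := hmin r hr hrn hre
  have hF : 0 < unifDiv (Fintype.card X) r := hδ.trans_le hFδ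
  -- The probability of revealing something is chosen to spend exactly $R$; it is below $1$ because
  -- $R<\delta\le D(r)$.
  set w := R / unifDiv (Fintype.card X) r with hw
  have hwF : w * unifDiv (Fintype.card X) r = R := div_mul_cancel₀ _ hF.ne'
  have hw0 : 0 < w := div_pos hR hF
  have hw1 : w < 1 := (div_lt_one hF).2 (hRδ.trans_le hFδ)
  have hch : IsChannel (peakChannel w (r i) z : X → Option X → ℝ) :=
    isChannel_peakChannel hw0.le hw1.le (hr.1 i) hz0 hyz
  have hIX : mutualInfo (jointXT (uniform X) (peakChannel w (r i) z : X → Option X → ℝ)) = R := by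
    rw [mutualInfo_jointXT hch, sum_peakChannel hw0.ne' hw1.ne hyz _ (unifDiv_const hN0.ne')
      (v := unifDiv (Fintype.card X) r) fun k => ?_, hwF]
    rw [hri, unifDiv_peak, unifDiv_peak]
    simp
  have hIY : mutualInfo (jointYT (uniform X) (hamming X α)
      (peakChannel w (r i) z : X → Option X → ℝ)) = l * R := by
    rw [mutualInfo_jointYT hch hα0 hα', sum_peakChannel hw0.ne' hw1.ne hyz
      (fun r => unifDiv (Fintype.card X) (smear (Fintype.card X) α r))
      (by simp only [smear_const hN0.ne', unifDiv_const hN0.ne'])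
      (v := l * unifDiv (Fintype.card X) r) fun k => ?_, mul_left_comm, hwF]
    rw [← hre, hri]
    simp only [smear_peak, unifDiv_peak, if_true]
  let e : Fin (Fintype.card X + 1) ≃ Option X :=
    (Fintype.equivFinOfCardEq (Fintype.card_option (α := X))).symm
  have hbest : IsFeasible (uniform X) R (fun x t => peakChannel w (r i) z x (e t)) := by
    refine ⟨fun x => ⟨fun t => (hch x).1 (e t), ?_⟩, ?_⟩
    · rw [← (hch x).2]
      exact e.sum_comp _
    · exact ((mutualInfo_comp_equiv e (jointXT (uniform X) (peakChannel w (r i) z))).trans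
        hIX).le
  have hbestY : mutualInfo (jointYT (uniform X) (hamming X α)
      (fun x t => peakChannel w (r i) z x (e t))) = l * R :=
    (mutualInfo_comp_equiv e (jointYT (uniform X) (hamming X α) (peakChannel w (r i) z))).trans hIY
  refine ⟨fun T _ K hK => ?_, _, hbest, ?_⟩
  · obtain ⟨⟨hKc, hKR⟩, -, hub⟩ := hK
    have hY : l * R ≤ mutualInfo (jointYT (uniform X) (hamming X α) K) :=
      hub ⟨_, _, hbest, hbestY⟩
    have hR' : R ≤ mutualInfo (jointXT (uniform X) K) :=
      le_of_mul_le_mul_left (hY.trans (mutualInfo_jointYT_le hKc hα0 hα' hmax)) hl0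
    have he := fun t => posterior_ratio_eq (t := t) hKc hα0 hα' hmax
      ((mul_le_mul_of_nonneg_left hKR hl0.le).trans hY)
    have hp : ∀ t, 0 < ∑ x, K x t → (∀ x, posterior K t x = 1 / (Fintype.card X : ℝ)) ∨
        ∃ i z, (∀ j, j ≠ i → posterior K t j = z) ∧ z < 1 / (Fintype.card X : ℝ) ∧
          1 / (Fintype.card X : ℝ) < posterior K t i := fun t ht =>
      or_iff_not_imp_left.2 fun hne => hpeak (posterior_mem_stdSimplex hKc ht) hne (he t ht)
    refine card_add_one_le hp ?_ (exists_heavy_posterior hKc (hR.trans_le hR') hp)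
    -- Without a uniform posterior, every letter of positive mass would have divergence at least
    -- $\delta$, so $I(X;T)\ge\delta>R$.
    by_contra! h
    refine (hKR.trans_lt hRδ).not_ge ?_
    calc δ = ∑ t, (∑ x, K x t) / (Fintype.card X : ℝ) * δ := by
          rw [← Finset.sum_mul, sum_mass hKc, one_mul]
      _ ≤ mutualInfo (jointXT (uniform X) K) := by
          rw [mutualInfo_jointXT hKc]
          refine Finset.sum_le_sum fun t _ => ?_
          have hS : 0 ≤ ∑ x, K x t := Finset.sum_nonneg fun x _ => (hKc x).1 t
          rcases hS.eq_or_lt with ht | ht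
          · simp [← ht]
          · refine mul_le_mul_of_nonneg_left ?_ (by positivity)
            exact hmin _ (posterior_mem_stdSimplex hKc ht)
              (by push Not; exact h t) (he t ht)
  · rw [hbestY]
    refine ⟨⟨_, _, hbest, hbestY⟩, ?_⟩
    rintro v ⟨m, K, ⟨hKc, hKR⟩, rfl⟩
    exact (mutualInfo_jointYT_le hKc hα0 hα' hmax).trans (mul_le_mul_of_nonneg_left hKR hl0.le)
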